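/- **Setting.** A network has a set of vertices (output ports) and a set of flows. The graph $\mathcal{G}(f)$ of a flow $f$ is a directed acyclic graph on the vertices with a unique source. A vertex sends a copy of each data unit of $f$ that exits it to each of its children in $\mathcal{G}(f)$; packets may be lost on transmission links and may have arbitrary delays. Some vertices contain a packet-elimination function (PEF) for $f$, which forwards, without delay, the first received packet of each data unit and discards the other ones. A vertex without PEF for $f$ is an EP-vertex of $\mathcal{G}(f)$ if it has several parents in $\mathcal{G}(f)$ or a parent that is an EP-vertex. A vertex $a$ of $\mathcal{G}(f)$ is a diamond ancestor of $n$ in $\mathcal{G}(f)$ if it is not an EP-vertex and every path of $\mathcal{G}(f)$ from the source to $n$ contains $a$. Let $\mathcal{F}$ be a set of one or more flows and $a\neq n$ two vertices such that $a$ is a diamond ancestor of $n$ in $\mathcal{G}(f)$ for each $f\in\mathcal{F}$. The data units of $\mathcal{F}$ that exit $a$ form a sequence, ordered by their exits from $a$ (the reference order). In $n$, the packets go through the following functions, in this order. * A set of parallel PEFs, one for each $f\in\mathcal{F}$. * One packet-ordering function (POF) for the aggregate $\mathcal{F}$ with reference $a$ and timeout $T\ge 0$. It releases a received data unit as soon as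 each data unit that precedes it in the reference order either has been received or is given up; a data unit is given up when one that follows it in the reference order was received at least $T$ ago. The timeout $T$ is at least the reordering late time offset of $\mathcal{F}$ at the output of the PEFs with reference $a$, that is, $T\ge E_k-E_j$ whenever $k$ precedes $j$ in the reference order and both reach the PEFs, at the instants $E_k$ and $E_j$. * One regulator for $\mathcal{F}$ with reference $a$ (a per-flow regulator if $\mathcal{F}$ has one flow, an interleaved regulator otherwise), with shaping curves $\sigma_f$, $f\in\mathcal{F}$. Each $\sigma_f$ is concave and is an arrival curve of $f$ at the output of $a$: the amount of data of $f$ that exits $a$ during $[s,t)$ is at most $\sigma_f(t-s)$, for all $s\le t$. The regulator is a FIFO queue; it releases its head-of-line packet as soon as doing so keeps the output of the flow $f$ of this packet $\sigma_f$-constrained. Let $\mathcal{S}$ be the system between the output of $a$ and the output of the PEFs, and $\mathcal{S}'$ the system between the output of $a$ and the output of the regulator. Let $d$ and $D$ be a lower and an upper bound for the delay through $\mathcal{S}$ of the data units of $\mathcal{F}$ that are not lost. **Theorem.** Every data unit of $\mathcal{F}$ that reaches the PEFs exited $a$ and exits the regulator, and: * if $\mathcal{S}$ is lossless for $\mathcal{F}$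 (for every data unit of $\mathcal{F}$ that exits $a$, at least one packet containing it reaches the PEFs), then $d$ and $D$ are also a lower and an upper bound for the delay of the data units of $\mathcal{F}$ through $\mathcal{S}'$; * otherwise, $d$ and $D+T$ are a lower and an upper bound for the delay through $\mathcal{S}'$ of the data units of $\mathcal{F}$ that are not lost. -/

import Mathlib

open scoped ENNReal NNReal

/-!
Time is counted in `ℝ≥0∞`; the instant `⊤` means "never".
-/

/-- The graph of a flow: a directed acyclic graph on the vertices (output ports) of the network,
all of which is reached from a unique source. -/
structure FlowGraph (V : Type*) where
  /-- `Adj u v`: the flow crosses `v` just after `u`. -/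
  Adj : V → V → Prop
  source : V
  acyclic : ∀ v, ¬ Relation.TransGen Adj v v
  reachable : ∀ u v, Adj u v → Relation.ReflTransGen Adj source u

/-- The paths of the flow from its source to a given vertex. Because a vertex sends one copy of
each incoming data unit to each of its children, a packet (replicate) of a data unit that is
located at `v` is identified by the path that it has followed from the source to `v`. -/
inductive FlowPath {V : Type*} (g : FlowGraph V) : V → Type _
  | source : FlowPath g g.source
  | step {u v : V} (p : FlowPath g u) (h : g.Adj u v) : FlowPath g v

/-- `p.Visits x`: the path `p` contains the vertex `x`. -/
def FlowPath.Visits {V : Type*} {g : FlowGraph V} : {v : V} → FlowPath g v → V → Prop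
  | _, .source, x => x = g.source
  | v, .step p _, x => x = v ∨ p.Visits x

/-- A network with vertices `V` crossed by the flows `Φ`: the graph of each flow, and the vertices
that contain a packet-elimination function (PEF) for the flow. The graph of the network is the union
of the graphs of the flows. -/
structure Network (V Φ : Type*) where
  graph : Φ → FlowGraph V
  pef : Φ → Set V

namespace Network

variable {V Φ : Type*} (N : Network V Φ)

/-- The EP-vertices of a flow: a vertex without PEF that has several parents, and a vertex without
PEF that is a child of an EP-vertex. -/
inductive IsEP (f : Φ) : V → Prop
  | merge {u w v : V} (hne : u ≠ w) (hu : (N.graph f).Adj u v) (hw : (N.graph f).Adj w v)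
      (hv : v ∉ N.pef f) : IsEP f v
  | child {u v : V} (hu : IsEP f u) (h : (N.graph f).Adj u v) (hv : v ∉ N.pef f) : IsEP f v

/-- `v` is a vertex of the graph of the flow `f`. -/
def IsVertex (f : Φ) (v : V) : Prop := Nonempty (FlowPath (N.graph f) v)

/-- `a` is a diamond ancestor of `n` in the graph of `f`. -/
def IsDiamondAncestor (f : Φ) (a n : V) : Prop :=
  N.IsVertex f a ∧ N.IsVertex f n ∧ ¬ N.IsEP f a ∧
    ∀ p : FlowPath (N.graph f) n, p.Visits a

end Network

/-- The `m`-th data unit of the flow `f` is `(f, m)`. -/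
abbrev DataUnit (Φ : Type*) := Φ × ℕ

/-- A trajectory of the network. For each packet (flow `f`, number `m` of the data unit, path
followed so far) it gives three instants at the last vertex of the path, each of them `⊤` when the
event never happens. -/
structure Run {V Φ : Type*} (N : Network V Φ) where
  /-- the length of the packets that transport a given data unit -/
  len : DataUnit Φ → ℝ≥0
  /-- entrance in the output port of the vertex; on the trivial path, it is the emission
  by the source application (`⊤` if the flow has no such data unit) -/
  arr : ∀ (f : Φ) (_ : ℕ) {v : V}, FlowPath (N.graph f) v → ℝ≥0∞
  /-- instant at which the packet is past the PEF of the vertex, if there is one (`⊤` if the packet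
  is discarded) -/
  fwd : ∀ (f : Φ) (_ : ℕ) {v : V}, FlowPath (N.graph f) v → ℝ≥0∞
  /-- exit of the vertex, at the end of the store-and-forward step of the next device (`⊤` if the
  packet is lost on the transmission link) -/
  dep : ∀ (f : Φ) (_ : ℕ) {v : V}, FlowPath (N.graph f) v → ℝ≥0∞
  /-- the switching fabric sends a copy to each child, without loss -/
  arr_step_ne_top : ∀ (f : Φ) (m : ℕ) {u v : V} (p : FlowPath (N.graph f) u)
    (h : (N.graph f).Adj u v), arr f m (p.step h) ≠ ⊤ ↔ dep f m p ≠ ⊤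
  dep_le_arr_step : ∀ (f : Φ) (m : ℕ) {u v : V} (p : FlowPath (N.graph f) u)
    (h : (N.graph f).Adj u v), dep f m p ≤ arr f m (p.step h)
  /-- without a PEF, every packet goes on -/
  fwd_of_notMem : ∀ (f : Φ) (m : ℕ) {v : V}, v ∉ N.pef f →
    ∀ p : FlowPath (N.graph f) v, fwd f m p = arr f m p
  /-- a PEF has no delay and forwards a packet only if it is a first one to arrive -/
  fwd_of_mem : ∀ (f : Φ) (m : ℕ) {v : V}, v ∈ N.pef f → ∀ p : FlowPath (N.graph f) v,
    fwd f m p ≠ ⊤ → fwd f m p = arr f m p ∧ ∀ q : FlowPath (N.graph f) v, arr f m p ≤ arr f m q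
  /-- a PEF forwards at most one packet per data unit -/
  fwd_unique : ∀ (f : Φ) (m : ℕ) {v : V}, v ∈ N.pef f → ∀ p q : FlowPath (N.graph f) v,
    fwd f m p ≠ ⊤ → fwd f m q ≠ ⊤ → p = q
  /-- a PEF forwards a packet of every data unit that it receives -/
  fwd_exists : ∀ (f : Φ) (m : ℕ) {v : V}, v ∈ N.pef f → ∀ p : FlowPath (N.graph f) v,
    arr f m p ≠ ⊤ → ∃ q : FlowPath (N.graph f) v, fwd f m q ≠ ⊤
  fwd_le_dep : ∀ (f : Φ) (m : ℕ) {v : V} (p : FlowPath (N.graph f) v), fwd f m p ≤ dep f m p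

namespace Run

variable {V Φ : Type*} {N : Network V Φ} (ρ : Run N)

/-- The instant at which a data unit exits the vertex `v` (in a packet; at a vertex that is not an
EP-vertex this happens at most once). -/
noncomputable def exitTime (v : V) (u : DataUnit Φ) : ℝ≥0∞ :=
  ⨅ p : FlowPath (N.graph u.1) v, ρ.dep u.1 u.2 p

/-- The instant at which a data unit of a flow `f` exits the function `PEF_n(f)`. -/
noncomputable def pefTime (n : V) (u : DataUnit Φ) : ℝ≥0∞ :=
  ⨅ p : FlowPath (N.graph u.1) n, ρ.fwd u.1 u.2 p

/-- The data units of the aggregate `F` that exit the vertex `a`. -/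
def aggregate (F : Set Φ) (a : V) : Set (DataUnit Φ) :=
  {u | u.1 ∈ F ∧ ρ.exitTime a u ≠ ⊤}

/-- The system between the output of `a` and the output of the PEFs of `n` is lossless for `F`. -/
def Lossless (F : Set Φ) (a n : V) : Prop :=
  ∀ u ∈ ρ.aggregate F a, ρ.pefTime n u ≠ ⊤

end Run

section Observation

variable {Φ : Type*}

/-- `rank` numbers the data units of `U` in the order in which they are observed, at the instants
`A`; data units that are observed at the same instant are numbered too. -/
def IsObservationOrder (U : Set (DataUnit Φ)) (A : DataUnit Φ → ℝ≥0∞) (rank : DataUnit Φ → ℕ) :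
    Prop :=
  Set.InjOn rank U ∧ ∀ u ∈ U, ∀ v ∈ U, rank u < rank v → A u ≤ A v

/-- `d` and `D` are a lower and an upper bound for the delay of the non-lost data units of the flows
`F` through a system that they enter at the instants `A` and exit at the instants `B`. -/
def DelayBounds (F : Set Φ) (A B : DataUnit Φ → ℝ≥0∞) (d D : ℝ≥0) : Prop :=
  ∀ u : DataUnit Φ, u.1 ∈ F → A u ≠ ⊤ → B u ≠ ⊤ → A u + d ≤ B u ∧ B u ≤ A u + D

/-- Amount of data of `S` observed during `[s, t)`, that is `R(t) - R(s)` with `R` the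
(left-continuous) cumulative function, when the data units are observed at the instants `A`. -/
noncomputable def traffic (len : DataUnit Φ → ℝ≥0) (S : Set (DataUnit Φ)) (A : DataUnit Φ → ℝ≥0∞)
    (s t : ℝ≥0) : ℝ≥0∞ :=
  ∑' u : {u : DataUnit Φ // u ∈ S ∧ (s : ℝ≥0∞) ≤ A u ∧ A u < t}, (len u : ℝ≥0∞)

/-- `σ` is an arrival curve for the data units of `S`, observed at the instants `A`. -/
def IsArrivalCurve (σ : ℝ≥0 → ℝ≥0∞) (len : DataUnit Φ → ℝ≥0) (S : Set (DataUnit Φ))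
    (A : DataUnit Φ → ℝ≥0∞) : Prop :=
  ∀ s t : ℝ≥0, s ≤ t → traffic len S A s t ≤ σ (t - s)

/-- The reordering late time offset (RTO) of the data units of `U` observed at the instants `E`,
with respect to the order `rank`: the largest lateness of a (non-lost) data unit with respect to a
data unit that comes after it in the reference order. -/
noncomputable def rto (U : Set (DataUnit Φ)) (rank : DataUnit Φ → ℕ) (E : DataUnit Φ → ℝ≥0∞) :
    ℝ≥0∞ :=
  ⨆ (k ∈ U) (j ∈ U) (_ : rank k < rank j) (_ : E k ≠ ⊤), E k - E j

/-- The packet-ordering function (POF) of the aggregate `U` with reference order `rank` and timeout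
`T`: the instant at which it releases `m`, when it receives the data units at the instants `E`.
A received data unit is released as soon as each of those that precede it in the reference order
either has been received or is given up, because a data unit that follows it in the reference order
was received at least `T` ago (in particular `m` itself does not wait longer than `T`). -/
noncomputable def pofTime (U : Set (DataUnit Φ)) (rank : DataUnit Φ → ℕ) (T : ℝ≥0)
    (E : DataUnit Φ → ℝ≥0∞) (m : DataUnit Φ) : ℝ≥0∞ :=
  sInf {t | E m ≤ t ∧ ∀ k ∈ U, rank k < rank m →
    E k ≤ t ∨ ∃ j ∈ U, rank k < rank j ∧ E j + T ≤ t}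

/-- `k` is released before `m` by a function that releases the data units of `U` at the instants
`G`, those of the same instant being released in the order `rank`. -/
def ReleasedBefore (U : Set (DataUnit Φ)) (rank : DataUnit Φ → ℕ) (G : DataUnit Φ → ℝ≥0∞)
    (k m : DataUnit Φ) : Prop :=
  k ∈ U ∧ G k ≠ ⊤ ∧ (G k < G m ∨ G k = G m ∧ rank k < rank m)

/-- `R` gives the release instants of the regulator with shaping curves `σ` (a per-flow regulator if
there is one flow only, an interleaved regulator otherwise) that receives the data units of `U` at
the instants `G`, in the order `before`. The regulator is a FIFO queue: `m` is at the head once it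
has been received and all the data units received before it have been released. The head-of-line
data unit is released at the earliest instant that does not violate the shaping curve of its flow,
that is, such that what the regulator has released for this flow, up to and including `m`, has this
curve as an arrival curve. -/
def IsRegulatorOutput (σ : Φ → ℝ≥0 → ℝ≥0∞) (len : DataUnit Φ → ℝ≥0) (U : Set (DataUnit Φ))
    (before : DataUnit Φ → DataUnit Φ → Prop) (G R : DataUnit Φ → ℝ≥0∞) : Prop :=
  open Classical in
  ∀ m ∈ U, IsLeast {t | G m ≤ t ∧ (∀ k, before k m → R k ≤ t) ∧
    IsArrivalCurve (σ m.1) len {k | k.1 = m.1 ∧ (before k m ∨ k = m)} (Function.update R m t)} (R m)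

end Observation

/-! Write `A`, `E`, `G`, `R` for the instants at the output of `a`, of the PEFs, of the POF and of
the regulator. Every function only delays, so `E ≤ G ≤ R`, which gives the lower bound.

For the upper bound, the POF releases `m` once all its predecessors are received. Without losses, a
predecessor `k` has `E k ≤ A k + D ≤ A m + D`, so `G m ≤ A m + D`: reordering costs nothing in the
worst case. With losses, the timeout started by `m` itself adds at most `T` (`pofTime_le_add`).

As `T` dominates the RTO, the POF restores the reference order (`pofTime_mono`). The regulator then
sees the traffic of `a` in its original order, delayed by at most `C` (`D` or `D + T`). Since that
traffic already satisfies the shaping curves, releasing `m` at `A m + C` is always permitted, and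
the regulator does so no later (`IsRegulatorOutput.le_add`). -/

theorem FlowPath.Visits.exists_dep_le {V Φ : Type*} {N : Network V Φ} (ρ : Run N) (f : Φ) (m : ℕ)
    {v x : V} (p : FlowPath (N.graph f) v) (hp : p.Visits x) :
    ∃ q : FlowPath (N.graph f) x, ρ.dep f m q ≤ ρ.dep f m p := by
  induction p with
  | source =>
    obtain rfl : x = (N.graph f).source := hp
    exact ⟨.source, le_rfl⟩
  | @step u v p h ih =>
    obtain rfl | hp : x = v ∨ p.Visits x := hp
    · exact ⟨p.step h, le_rfl⟩
    · obtain ⟨q, hq⟩ := ih hp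
      -- Instants never decrease along a path; a packet discarded by a PEF has `fwd = ⊤`.
      have harr : ρ.arr f m (p.step h) ≤ ρ.fwd f m (p.step h) := by
        by_cases hv : v ∈ N.pef f
        · by_cases htop : ρ.fwd f m (p.step h) = ⊤
          · exact htop ▸ le_top
          · exact (ρ.fwd_of_mem f m hv _ htop).1.ge
        · exact (ρ.fwd_of_notMem f m hv _).ge
      exact ⟨q, hq.trans ((ρ.dep_le_arr_step f m p h).trans (harr.trans (ρ.fwd_le_dep f m _)))⟩

/-- A data unit that reaches the PEF of `n` has exited each vertex `a ≠ n` that all the paths to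
`n` contain. -/
theorem Run.exitTime_ne_top_of_pefTime_ne_top {V Φ : Type*} {N : Network V Φ} (ρ : Run N)
    {a n : V} (han : a ≠ n) {u : DataUnit Φ}
    (hvisits : ∀ p : FlowPath (N.graph u.1) n, p.Visits a) (hpef : n ∈ N.pef u.1)
    (hu : ρ.pefTime n u ≠ ⊤) : ρ.exitTime a u ≠ ⊤ := by
  obtain ⟨p, hp⟩ : ∃ p : FlowPath (N.graph u.1) n, ρ.fwd u.1 u.2 p ≠ ⊤ := by
    by_contra! h
    exact hu (by simp [Run.pefTime, h])
  have harr := (ρ.fwd_of_mem u.1 u.2 hpef p hp).1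
  cases p with
  -- The trivial path visits only `n`, and `a ≠ n`.
  | source => exact absurd (hvisits .source) han
  | step p h =>
    obtain ⟨q, hq⟩ := ((hvisits (p.step h)).resolve_left han).exists_dep_le ρ u.1 u.2
    have hdep : ρ.dep u.1 u.2 p ≠ ⊤ := (ρ.arr_step_ne_top u.1 u.2 p h).1 (harr ▸ hp)
    exact ne_top_of_le_ne_top hdep ((iInf_le _ q).trans hq)

section Observation

variable {Φ : Type*} {U : Set (DataUnit Φ)} {rank : DataUnit Φ → ℕ} {T : ℝ≥0}
  {E : DataUnit Φ → ℝ≥0∞}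

theorem le_pofTime (m : DataUnit Φ) : E m ≤ pofTime U rank T E m :=
  le_sInf fun _ ht => ht.1

/-- At this instant `m` itself witnesses that every missing predecessor is given up. -/
theorem pofTime_le_add {m : DataUnit Φ} (hm : m ∈ U) : pofTime U rank T E m ≤ E m + T :=
  sInf_le ⟨le_self_add, fun _ _ hk => .inr ⟨m, hm, hk, le_rfl⟩⟩

theorem pofTime_ne_top {m : DataUnit Φ} (hm : m ∈ U) (hE : E m ≠ ⊤) :
    pofTime U rank T E m ≠ ⊤ :=
  ne_top_of_le_ne_top (ENNReal.add_ne_top.2 ⟨hE, ENNReal.coe_ne_top⟩) (pofTime_le_add hm)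

/-- Without losses, the POF releases a data unit no later than the last reception of a data unit
that does not follow it. -/
theorem pofTime_le_of_forall_le {m : DataUnit Φ} {t : ℝ≥0∞} (hm : E m ≤ t)
    (h : ∀ k ∈ U, rank k < rank m → E k ≤ t) : pofTime U rank T E m ≤ t :=
  sInf_le ⟨hm, fun k hk hkm => .inl (h k hk hkm)⟩

/-- If its timeout is at least the RTO at its input, then the POF releases the data units in the
reference order. -/
theorem pofTime_mono (hT : rto U rank E ≤ T) {k m : DataUnit Φ} (hk : k ∈ U) (hE : E k ≠ ⊤)
    (hkm : rank k < rank m) : pofTime U rank T E k ≤ pofTime U rank T E m := by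
  refine le_sInf fun t ht => sInf_le ⟨?_, fun l hl hlk => ht.2 l hl (hlk.trans hkm)⟩
  -- If `k` is given up because of `j`, the RTO bound still gives `E k ≤ E j + T ≤ t`: only lost
  -- data units are ever abandoned.
  obtain h | ⟨j, hj, hkj, hjt⟩ := ht.2 k hk hkm
  · exact h
  · refine le_trans ?_ hjt
    rw [add_comm, ← tsub_le_iff_right]
    refine le_trans ?_ hT
    exact le_iSup₂_of_le k hk (le_iSup₂_of_le j hj (le_iSup₂_of_le hkj hE le_rfl))

theorem traffic_mono {len : DataUnit Φ → ℝ≥0} {S S' : Set (DataUnit Φ)}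
    {A A' : DataUnit Φ → ℝ≥0∞} {s t s' t' : ℝ≥0}
    (h : ∀ u ∈ S, (s : ℝ≥0∞) ≤ A u → A u < t → u ∈ S' ∧ (s' : ℝ≥0∞) ≤ A' u ∧ A' u < t') :
    traffic len S A s t ≤ traffic len S' A' s' t' :=
  ENNReal.tsum_mono_subtype (fun u => (len u : ℝ≥0∞))
    (s := {u | u ∈ S ∧ (s : ℝ≥0∞) ≤ A u ∧ A u < t})
    (t := {u | u ∈ S' ∧ (s' : ℝ≥0∞) ≤ A' u ∧ A' u < t'}) fun u hu => h u hu.1 hu.2.1 hu.2.2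

theorem traffic_eq_zero {len : DataUnit Φ → ℝ≥0} {S : Set (DataUnit Φ)}
    {A : DataUnit Φ → ℝ≥0∞} {s t : ℝ≥0} (h : ∀ u ∈ S, (s : ℝ≥0∞) ≤ A u → ¬ A u < t) :
    traffic len S A s t = 0 := by
  have : IsEmpty {u : DataUnit Φ // u ∈ S ∧ (s : ℝ≥0∞) ≤ A u ∧ A u < t} :=
    ⟨fun u => h u.1 u.2.1 u.2.2.1 u.2.2.2⟩
  exact tsum_empty

theorem le_regulatorOutput {σ : Φ → ℝ≥0 → ℝ≥0∞} {len : DataUnit Φ → ℝ≥0}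
    {before : DataUnit Φ → DataUnit Φ → Prop} {G R : DataUnit Φ → ℝ≥0∞}
    (hR : IsRegulatorOutput σ len U before G R) {m : DataUnit Φ} (hm : m ∈ U) : G m ≤ R m :=
  (hR m hm).1.1

theorem IsRegulatorOutput.isArrivalCurve {σ : Φ → ℝ≥0 → ℝ≥0∞} {len : DataUnit Φ → ℝ≥0}
    {before : DataUnit Φ → DataUnit Φ → Prop} {G R : DataUnit Φ → ℝ≥0∞}
    (hR : IsRegulatorOutput σ len U before G R) {m : DataUnit Φ} (hm : m ∈ U) :
    IsArrivalCurve (σ m.1) len {k | k.1 = m.1 ∧ (before k m ∨ k = m)} R := by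
  classical
  have h := (hR m hm).1.2.2
  convert h using 1
  exact (Function.update_eq_self m R).symm

/-- Shaping is for free: if the data units of `U` are observed in the order `rank` at the instants
`A`, where the shaping curves are arrival curves, and reach the regulator in the order `rank` with a
delay of at most `C`, then they exit the regulator with a delay of at most `C`. -/
theorem IsRegulatorOutput.le_add {σ : Φ → ℝ≥0 → ℝ≥0∞} {len : DataUnit Φ → ℝ≥0}
    {A G R : DataUnit Φ → ℝ≥0∞} {C : ℝ≥0}
    (hR : IsRegulatorOutput σ len U (ReleasedBefore U rank G) G R)
    (hrank : IsObservationOrder U A rank) (hA : ∀ u ∈ U, A u ≠ ⊤)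
    (hσ : ∀ u ∈ U, IsArrivalCurve (σ u.1) len {v | v.1 = u.1} A)
    (hmono : ∀ k ∈ U, ∀ m ∈ U, G k ≠ ⊤ → G m ≠ ⊤ → rank k < rank m → G k ≤ G m)
    (hC : ∀ u ∈ U, G u ≠ ⊤ → G u ≤ A u + C) {m : DataUnit Φ} (hm : m ∈ U) (hGm : G m ≠ ⊤) :
    R m ≤ A m + C := by
  classical
  -- With ties broken by `rank`, the FIFO order is the reference order on the received data units.
  have hbefore {k m : DataUnit Φ} (hm : m ∈ U) (hGm : G m ≠ ⊤) :
      ReleasedBefore U rank G k m ↔ k ∈ U ∧ G k ≠ ⊤ ∧ rank k < rank m := by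
    refine ⟨fun ⟨hk, hGk, h⟩ => ⟨hk, hGk, ?_⟩, fun ⟨hk, hGk, h⟩ => ⟨hk, hGk, ?_⟩⟩
    · obtain h | h := h
      · by_contra! hle
        obtain hlt | heq := hle.lt_or_eq
        · exact (hmono m hm k hk hGm hGk hlt).not_gt h
        · exact h.ne (congrArg G (hrank.1 hk hm heq.symm))
      · exact h.2
    · exact (hmono k hk m hm hGk hGm h).lt_or_eq.imp_right fun heq => ⟨heq, h⟩
  have hAmono {k m : DataUnit Φ} (hk : k ∈ U) (hm : m ∈ U) (h : rank k ≤ rank m) : A k ≤ A m := by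
    obtain h | h := h.lt_or_eq
    · exact hrank.2 k hk m hm h
    · exact (congrArg A (hrank.1 hk hm h)).le
  induction hr : rank m using Nat.strong_induction_on generalizing m with
  | _ r ih =>
  subst hr
  have ih' {k : DataUnit Φ} (hk : ReleasedBefore U rank G k m) : R k ≤ A k + C := by
    obtain ⟨hkU, hGk, hkm⟩ := (hbefore hm hGm).1 hk
    exact ih _ hkm hkU hGk rfl
  have hbU {k : DataUnit Φ} (hk : ReleasedBefore U rank G k m ∨ k = m) :
      k ∈ U ∧ G k ≠ ⊤ ∧ rank k ≤ rank m := by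
    obtain hk | rfl := hk
    · obtain ⟨hkU, hGk, hkm⟩ := (hbefore hm hGm).1 hk
      exact ⟨hkU, hGk, hkm.le⟩
    · exact ⟨hm, hGm, le_rfl⟩
  -- `R m` is the least admissible instant, so it suffices that `A m + C` is admissible.
  refine (hR m hm).2 ⟨hC m hm hGm, fun k hk => (ih' hk).trans ?_, ?_⟩
  · gcongr
    exact hAmono hk.1 hm ((hbefore hm hGm).1 hk).2.2.le
  intro s t hst
  set B : DataUnit Φ → ℝ≥0∞ := Function.update R m (A m + C) with hB
  have hBm : B m = A m + C := Function.update_self ..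
  have hBk {k : DataUnit Φ} (hk : k ≠ m) : B k = R k := Function.update_of_ne hk ..
  have hBle {k : DataUnit Φ} (hk : ReleasedBefore U rank G k m ∨ k = m) : B k ≤ A k + C := by
    by_cases hkm : k = m
    · rw [hkm, hBm]
    · rw [hBk hkm]
      exact ih' (hk.resolve_right hkm)
  set W : Set (DataUnit Φ) :=
    {k | (k.1 = m.1 ∧ (ReleasedBefore U rank G k m ∨ k = m)) ∧ (s : ℝ≥0∞) ≤ B k ∧ B k < t} with hW
  by_cases hmW : m ∈ W
  -- With `k₁` the first data unit of the window, `s ≤ A k₁ + C` and `A m + C < t`. So the whole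
  -- window exited `a` during `[A k₁, A k₁ + (t - s))`, where `σ` bounds the traffic by `σ (t - s)`.
  · obtain ⟨k₁, hk₁, hmin⟩ := exists_minimalFor_of_wellFoundedLT (· ∈ W) rank ⟨m, hmW⟩
    have hmin' {k : DataUnit Φ} (hk : k ∈ W) : rank k₁ ≤ rank k :=
      (le_total (rank k₁) (rank k)).elim id fun h => hmin hk h
    obtain ⟨hk₁U, -, hk₁m⟩ := hbU hk₁.1.2
    obtain ⟨x, hx⟩ : ∃ x : ℝ≥0, (x : ℝ≥0∞) = A k₁ := ⟨_, ENNReal.coe_toNNReal (hA k₁ hk₁U)⟩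
    obtain ⟨y, hy⟩ : ∃ y : ℝ≥0, (y : ℝ≥0∞) = A m := ⟨_, ENNReal.coe_toNNReal (hA m hm)⟩
    have hsx : s ≤ x + C := by
      have := hk₁.2.1.trans (hBle hk₁.1.2)
      rw [← hx] at this
      exact_mod_cast this
    have hyt : y + C < t := by
      have := hmW.2.2
      rw [hBm, ← hy] at this
      exact_mod_cast this
    have hyz : y < x + (t - s) := by
      rw [← NNReal.coe_lt_coe] at hyt ⊢
      rw [← NNReal.coe_le_coe] at hsx
      push_cast [NNReal.coe_sub hst] at *
      linarith
    refine le_trans (traffic_mono fun u huS hsu hut => ?_)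
      ((hσ m hm x (x + (t - s)) le_self_add).trans_eq (by rw [add_tsub_cancel_left]))
    have huW : u ∈ W := ⟨huS, hsu, hut⟩
    obtain ⟨huU, -, hum⟩ := hbU huS.2
    refine ⟨huS.1, hx ▸ hAmono hk₁U huU (hmin' huW), (hAmono huU hm hum).trans_lt ?_⟩
    rw [← hy]
    exact_mod_cast hyz
  -- The window misses `m`, so the tentative instant plays no role: the constraint enforced when its
  -- last data unit was released already covers it.
  · obtain hempty | hne := W.eq_empty_or_nonempty
    · rw [traffic_eq_zero fun u huS hsu hut => ?_]
      · exact zero_le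
      · exact (hempty ▸ (show u ∈ W from ⟨huS, hsu, hut⟩) : u ∈ (∅ : Set (DataUnit Φ)))
    · obtain ⟨k, hkW, hmax⟩ : ∃ k ∈ W, ∀ u ∈ W, rank u ≤ rank k := by
        have hbdd : BddAbove (rank '' W) :=
          ⟨rank m, by rintro _ ⟨u, hu, rfl⟩; exact (hbU hu.1.2).2.2⟩
        obtain ⟨k, hk, hk'⟩ := Nat.sSup_mem (hne.image rank) hbdd
        exact ⟨k, hk, fun u hu => hk' ▸ le_csSup hbdd ⟨u, hu, rfl⟩⟩
      obtain ⟨hkU, hGk, -⟩ := hbU hkW.1.2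
      refine le_trans (traffic_mono fun u huS hsu hut => ?_)
        (hkW.1.1 ▸ hR.isArrivalCurve hkU s t hst)
      have huW : u ∈ W := ⟨huS, hsu, hut⟩
      obtain ⟨huU, hGu, -⟩ := hbU huS.2
      have hum : u ≠ m := fun h => hmW (h ▸ huW)
      rw [hBk hum] at hsu hut
      refine ⟨⟨huS.1, ?_⟩, hsu, hut⟩
      obtain hlt | heq := (hmax u huW).lt_or_eq
      · exact .inl ((hbefore hkU hGk).2 ⟨huU, hGu, hlt⟩)
      · exact .inr (hrank.1 huU hkU heq)

end Observation

theorem theorem5 {V Φ : Type*} (N : Network V Φ) (ρ : Run N)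
    (F : Set Φ) (hF : F.Nonempty) (a n : V) (han : a ≠ n)
    (hdiamond : ∀ f ∈ F, N.IsDiamondAncestor f a n)
    (hpef : ∀ f ∈ F, n ∈ N.pef f)
    -- the order in which the data units of the aggregate exit `a`
    (rank : DataUnit Φ → ℕ)
    (hrank : IsObservationOrder (ρ.aggregate F a) (ρ.exitTime a) rank)
    -- the timeout of the POF is not smaller than the RTO at its input
    (T : ℝ≥0) (hT : rto (ρ.aggregate F a) rank (ρ.pefTime n) ≤ T)
    -- the shaping curves are concave, and arrival curves at the output of `a`
    (σ : Φ → ℝ≥0 → ℝ≥0∞)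
    (hconc : ∀ f ∈ F, ConcaveOn ℝ≥0 Set.univ (σ f))
    (hσ : ∀ f ∈ F, IsArrivalCurve (σ f) ρ.len {u | u.1 = f} (ρ.exitTime a))
    -- the output of the POF, and of the regulator that comes after it
    (G R : DataUnit Φ → ℝ≥0∞)
    (hG : G = pofTime (ρ.aggregate F a) rank T (ρ.pefTime n))
    (hR : IsRegulatorOutput σ ρ.len (ρ.aggregate F a)
      (ReleasedBefore (ρ.aggregate F a) rank G) G R)
    -- the delay bounds through the system between `a` and the output of the PEFs
    (d D : ℝ≥0) (hdD : DelayBounds F (ρ.exitTime a) (ρ.pefTime n) d D) :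
    -- each data unit that reaches the PEFs entered at `a` and exits the regulator
    (∀ u : DataUnit Φ, u.1 ∈ F → ρ.pefTime n u ≠ ⊤ → ρ.exitTime a u ≠ ⊤ ∧ R u ≠ ⊤) ∧
    (ρ.Lossless F a n → DelayBounds F (ρ.exitTime a) R d D) ∧
    (¬ ρ.Lossless F a n → DelayBounds F (ρ.exitTime a) R d (D + T)) := by
  have hexit {u : DataUnit Φ} (hu : u.1 ∈ F) (hE : ρ.pefTime n u ≠ ⊤) : ρ.exitTime a u ≠ ⊤ :=
    ρ.exitTime_ne_top_of_pefTime_ne_top han (hdiamond _ hu).2.2.2 (hpef _ hu) hE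
  have hEG (u : DataUnit Φ) : ρ.pefTime n u ≤ G u := hG ▸ le_pofTime u
  have hER {u : DataUnit Φ} (hu : u ∈ ρ.aggregate F a) : ρ.pefTime n u ≤ R u :=
    (hEG u).trans (le_regulatorOutput hR hu)
  have hGtop {u : DataUnit Φ} (hu : u ∈ ρ.aggregate F a) (hE : ρ.pefTime n u ≠ ⊤) : G u ≠ ⊤ :=
    hG ▸ pofTime_ne_top hu hE
  have hdelay {C : ℝ≥0} (hC : ∀ u ∈ ρ.aggregate F a, ρ.pefTime n u ≠ ⊤ →
      G u ≤ ρ.exitTime a u + C) {u : DataUnit Φ} (hu : u ∈ ρ.aggregate F a)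
      (hE : ρ.pefTime n u ≠ ⊤) : R u ≤ ρ.exitTime a u + C := by
    refine hR.le_add hrank (fun v hv => hv.2) (fun v hv => hσ _ hv.1) ?_
      (fun v hv h => hC v hv (ne_top_of_le_ne_top h (hEG v))) hu (hGtop hu hE)
    intro k hk m _ hGk _ hkm
    have hEk := ne_top_of_le_ne_top hGk (hEG k)
    subst hG
    exact pofTime_mono hT hk hEk hkm
  have hbounds {C : ℝ≥0} (hC : ∀ u ∈ ρ.aggregate F a, ρ.pefTime n u ≠ ⊤ →
      G u ≤ ρ.exitTime a u + C) : DelayBounds F (ρ.exitTime a) R d C := by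
    intro u hu hA hRu
    have huU : u ∈ ρ.aggregate F a := ⟨hu, hA⟩
    have hE : ρ.pefTime n u ≠ ⊤ := ne_top_of_le_ne_top hRu (hER huU)
    exact ⟨(hdD u hu hA hE).1.trans (hER huU), hdelay hC huU hE⟩
  -- This bound holds with or without losses, so it also yields the finiteness of `R`.
  have hlossy (u : DataUnit Φ) (hu : u ∈ ρ.aggregate F a) (hE : ρ.pefTime n u ≠ ⊤) :
      G u ≤ ρ.exitTime a u + (D + T : ℝ≥0) := by
    rw [ENNReal.coe_add, ← add_assoc, hG]
    exact (pofTime_le_add hu).trans (add_le_add_left (hdD u hu.1 hu.2 hE).2 _)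
  refine ⟨fun u hu hE => ?_, fun hlossless => hbounds fun u hu hE => ?_, fun _ => hbounds hlossy⟩
  · have hA := hexit hu hE
    exact ⟨hA, ne_top_of_le_ne_top (ENNReal.add_ne_top.2 ⟨hA, ENNReal.coe_ne_top⟩)
      (hdelay hlossy ⟨hu, hA⟩ hE)⟩
  · rw [hG]
    refine pofTime_le_of_forall_le (hdD u hu.1 hu.2 hE).2 fun k hk hku => ?_
    -- Losslessness is what makes the delay bound apply to each predecessor `k`.
    exact (hdD k hk.1 hk.2 (hlossless k hk)).2.trans (add_le_add_left (hrank.2 k hk u hu hku) _)
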